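/- Let $p\ge 1$, $G\subseteq\mathbb R^p$, $\mathcal T\subseteq\mathbb R$, $\lambda>0$, and let $\mu$ be a probability measure on $\mathcal T$. Let $W$ be an orthogonal random measure on $\mathbb R^p$ with intensity $\lambda$: for measurable sets $A,B$ of finite Lebesgue measure, $W(A)$ is square-integrable, $\mathbb E\,W(A)=0$ and $\mathbb E\big(W(A)W(B)\big)=\lambda|A\cap B|$. Let $\{T(u):u\in\mathbb R^p\}$ be a family of independent random variables with values in $\mathcal T$ and common law $\mu$, independent of $W$. For $x\in G$ let $(u,t)\mapsto f_x(u;t)$ be measurable on $\mathbb R^p\times\mathcal T$, with $f_x(\cdot;t)$ square-integrable on $\mathbb R^p$ for every $t\in\mathcal T$, and such that for every $u$ the first two moments of $f_x(u;T(u))$ are finite, and they are integrable over $\mathbb R^p$ as functions of $u$. Consider the generalized convolution model $$Z(x)=\int_{\mathbb R^p}f_x(u;T(u))\,W(du),\qquad x\in G.$$ Here the family $T$, defined on $(\Theta,P_\Theta)$, is jointly measurable in $(u,\theta)$ with respect to a Fubini extension of the product of $\mathbb R^p$ and $\Theta$, where the $\sigma$-algebra of $\mathbb R^p$ and Lebesgue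 measure $|\cdot|$ on it (also as the domain of $W$) may be extensions of the Borel $\sigma$-algebra and Lebesgue measure; $W$ is defined on $(\Omega,P_\Omega)$; each $Z(x)$ is a random variable on a Fubini extension of $(\Theta,P_\Theta)\times(\Omega,P_\Omega)$ such that for almost every $\theta$ the variable $Z(x)(\theta,\cdot)$ is the mean square stochastic integral with respect to $W$ of the square-integrable function $u\mapsto f_x(u;T(u)(\theta))$. (A Fubini extension of a product of two measure spaces is a measure on a $\sigma$-algebra containing the product $\sigma$-algebra, such that for each nonnegative measurable function both iterated integrals are defined and equal to the joint integral. The product measure of $\sigma$-finite measures is an example.) Then, for all $x,y\in G$ and $t\in\mathcal T$, $Z(x)$ is square-integrable, $\mathbb E\,Z(x)=0$, the integral $$C(x,y;t)=\int_{\mathbb R^p}f_x(u;t)f_y(u;t)\,du$$ converges absolutely, $C(x,y;\cdot)$ is integrable with respect to $M(dt)=\lambda\,\mu(dt)$, and $$\operatorname{Cov}(Z(x),Z(y))=\int_{\mathcal T}C(x,y;t)\,M(dt).$$ The function $(x,y)\mapsto\int_{\mathcal T}C(x,y;t)\,M(dt)$ is a valid covariance function on $G\times G$: it is symmetric and positive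 definite, that is, $\sum_{i,j}a_ia_j\int_{\mathcal T}C(x_i,x_j;t)\,M(dt)\ge 0$ for all finitely many $x_i\in G$ and $a_i\in\mathbb R$. The covariances obtained are in general non-stationary: if $G$ has at least two points, then for the given $\lambda,\mu,W,T$ there are weighting functions $f'$ satisfying the assumptions, and a corresponding model $Z'$, whose covariance is not a function of $x-y$ alone. -/

import Mathlib

open MeasureTheory ProbabilityTheory Filter Topology

noncomputable section

/-- The points of `ℝ^p` as indices of random objects. This is `ℝ^p` itself, but it does not inherit
the Borel σ-algebra, so that it can carry a σ-algebra that extends the Borel one: a non-degenerate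
family of independent variables indexed by all points of `ℝ^p` is never jointly measurable for the
Borel σ-algebra on the index set. -/
def Site (p : ℕ) : Type := EuclideanSpace ℝ (Fin p)

/-- The point of `ℝ^p` that an index is (the identity map). -/
def Site.loc {p : ℕ} : Site p → EuclideanSpace ℝ (Fin p) := fun u => u

/-- A Fubini extension (Y. Sun) of the product of two measure spaces: a measure on a σ-algebra on
`X × Y` that contains the product σ-algebra, for which the sections of jointly measurable functions
are (almost all, up to null sets) measurable and both iterated integrals give the joint integral.
For σ-finite measures the product measure itself is one. -/
structure FubiniExtension {X Y : Type*} [MeasurableSpace X] [MeasurableSpace Y]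
    (ν : Measure X) (ρ : Measure Y) where
  /-- the joint σ-algebra -/
  sigma : MeasurableSpace (X × Y)
  /-- it contains the product σ-algebra -/
  prod_le : (Prod.instMeasurableSpace : MeasurableSpace (X × Y)) ≤ sigma
  /-- the joint measure -/
  joint : @Measure (X × Y) sigma
  left : ∀ g : X × Y → ENNReal, Measurable[sigma] g →
    (∀ᵐ x ∂ν, AEMeasurable (fun y => g (x, y)) ρ) ∧
    AEMeasurable (fun x => ∫⁻ y, g (x, y) ∂ρ) ν ∧
    ∫⁻ q, g q ∂joint = ∫⁻ x, ∫⁻ y, g (x, y) ∂ρ ∂ν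
  right : ∀ g : X × Y → ENNReal, Measurable[sigma] g →
    (∀ᵐ y ∂ρ, AEMeasurable (fun x => g (x, y)) ν) ∧
    AEMeasurable (fun y => ∫⁻ x, g (x, y) ∂ν) ρ ∧
    ∫⁻ q, g q ∂joint = ∫⁻ y, ∫⁻ x, g (x, y) ∂ν ∂ρ

/-- `W` is an orthogonal random measure with intensity `lam` and control measure `ν`:
`E W(A) = 0` and `E (W(A) W(B)) = lam * ν (A ∩ B)`, the integrated form of
`E (W(du) W(dv)) = lam δ_u(dv) du`. Additivity of `W` in mean square, also countable, follows. -/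
structure IsOrthogonalRandomMeasure {S Ω : Type*} [MeasurableSpace S] [MeasurableSpace Ω]
    (W : Set S → Ω → ℝ) (lam : ℝ) (ν : Measure S) (P : Measure Ω) : Prop where
  memLp : ∀ A, MeasurableSet A → ν A < ⊤ → MemLp (W A) 2 P
  mean : ∀ A, MeasurableSet A → ν A < ⊤ → ∫ ω, W A ω ∂P = 0
  orthogonal : ∀ A B, MeasurableSet A → MeasurableSet B → ν A < ⊤ → ν B < ⊤ →
    ∫ ω, W A ω * W B ω ∂P = lam * ν.real (A ∩ B)

/-- The integral of a simple function with respect to `W`. -/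
def simpleStochasticIntegral {S Ω : Type*} [MeasurableSpace S] (W : Set S → Ω → ℝ)
    (s : SimpleFunc S ℝ) (ω : Ω) : ℝ :=
  ∑ c ∈ s.range, c * W (s ⁻¹' {c}) ω

/-- `Y` is (a version of) the stochastic integral `∫ h(u) W(du)` of the deterministic function
`h ∈ L²(ν)`: the mean square limit of the integrals of simple functions that tend to `h`
in `L²(ν)`. -/
def IsStochasticIntegral {S Ω : Type*} [MeasurableSpace S] [MeasurableSpace Ω]
    (W : Set S → Ω → ℝ) (ν : Measure S) (P : Measure Ω) (h : S → ℝ) (Y : Ω → ℝ) : Prop :=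
  MemLp h 2 ν ∧ MemLp Y 2 P ∧ ∃ s : ℕ → SimpleFunc S ℝ,
    (∀ n, MemLp (s n) 2 ν) ∧
    Tendsto (fun n => eLpNorm (fun u => s n u - h u) 2 ν) atTop (𝓝 0) ∧
    Tendsto (fun n => eLpNorm (fun ω => simpleStochasticIntegral W (s n) ω - Y ω) 2 P)
      atTop (𝓝 0)

/-- The generalized convolution model `Z(x) = ∫ f_x(u; T(u)) W(du)`, `x ∈ G`.
The family `T` lives on `(Θ, PΘ)`, the random measure `W` on `(Ω, PΩ)`, and both on `Θ × Ω` with the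
joint law `K.joint` which extends the product law, so that `T` and `W` are independent. -/
structure IsConvolutionModel {p : ℕ} {G : Set (EuclideanSpace ℝ (Fin p))} {𝒯 : Set ℝ}
    {Θ Ω : Type*} [MeasurableSpace (Site p)] [MeasurableSpace Θ] [MeasurableSpace Ω]
    (lam : ℝ) (μ : Measure 𝒯) (ν : Measure (Site p)) (PΘ : Measure Θ) (PΩ : Measure Ω)
    (J : FubiniExtension ν PΘ) (K : FubiniExtension PΘ PΩ)
    (W : Set (Site p) → Ω → ℝ) (T : Site p → Θ → 𝒯)
    (f : G → EuclideanSpace ℝ (Fin p) → 𝒯 → ℝ) (Z : G → Θ × Ω → ℝ) : Prop where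
  /-- `ν` is Lebesgue measure, possibly extended to more sets than the Borel sets -/
  lebesgue : MeasurePreserving Site.loc ν volume
  /-- `W` is an orthogonal random measure with intensity `lam` -/
  noise : IsOrthogonalRandomMeasure W lam ν PΩ
  /-- the `T(u)` are random variables, -/
  measurable_T : ∀ u, Measurable (T u)
  /-- jointly measurable in the index and the random element, -/
  jointly_measurable_T : Measurable[J.sigma] (fun q : Site p × Θ => T q.1 q.2)
  /-- mutually independent, -/
  indep_T : iIndepFun T PΘ
  /-- with the common law `μ` -/
  law_T : ∀ u, PΘ.map (T u) = μ
  /-- the weighting functions are measurable -/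
  measurable_f : ∀ x, Measurable (fun q : EuclideanSpace ℝ (Fin p) × 𝒯 => f x q.1 q.2)
  /-- and square-integrable on `ℝ^p` -/
  memLp_f : ∀ x t, MemLp (fun u => f x u t) 2 volume
  /-- the first two moments of `f_x(u; T(u))` are finite -/
  finite_moments : ∀ x u, MemLp (fun θ => f x (Site.loc u) (T u θ)) 2 PΘ
  /-- and integrable on `ℝ^p` -/
  integrable_first : ∀ x, Integrable (fun u => ∫ θ, f x (Site.loc u) (T u θ) ∂PΘ) ν
  integrable_second : ∀ x, Integrable (fun u => ∫ θ, f x (Site.loc u) (T u θ) ^ 2 ∂PΘ) ν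
  /-- `Z(x)` is a random variable -/
  measurable_Z : ∀ x, @AEStronglyMeasurable _ _ _ K.sigma K.sigma (Z x) K.joint
  /-- and `Z(x) = ∫ f_x(u; T(u)) W(du)`, for almost every realization of the family `T` -/
  integral_Z : ∀ x, ∀ᵐ θ ∂PΘ,
    IsStochasticIntegral W ν PΩ (fun u => f x (Site.loc u) (T u θ)) (fun ω => Z x (θ, ω))

/-- `C(x, y; t) = ∫ f_x(u; t) f_y(u; t) du`. -/
def convolutionCov {p : ℕ} {G : Set (EuclideanSpace ℝ (Fin p))} {𝒯 : Set ℝ}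
    (f : G → EuclideanSpace ℝ (Fin p) → 𝒯 → ℝ) (x y : G) (t : 𝒯) : ℝ :=
  ∫ u, f x u t * f y u t

/-- The measure `M(dt) = lam μ(dt)`. -/
def mixingMeasure {𝒯 : Set ℝ} (lam : ℝ) (μ : Measure 𝒯) : Measure 𝒯 := ENNReal.ofReal lam • μ

/-- A covariance function on `G` is stationary if it depends on `x - y` only. -/
def IsStationaryCovariance {p : ℕ} {G : Set (EuclideanSpace ℝ (Fin p))} (C : G → G → ℝ) : Prop :=
  ∀ x y x' y' : G, (x : EuclideanSpace ℝ (Fin p)) - y = x' - y' → C x y = C x' y'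

end

open scoped ENNReal

/-! Freeze a realization `θ` of the family `T`. Then `Z x (θ, ·)` is the stochastic integral of a
deterministic function, so it has mean zero, and the Itô isometry
(`IsStochasticIntegral.integral_mul`) gives its conditional second moments as `lam * ∫ f_x f_y`
along that realization. To average over `θ`, integrate over sites and realizations jointly: each `T
u` has law `μ`, so `(u, θ) ↦ (u, T u θ)` carries the joint measure to Lebesgue measure times `μ`
(`measurePreserving_loc_T`). Integrating the two sides in the other order, over `θ` and over `t`
last, turns the average into `∫ C(x, y; t) μ(dt)` (`integral_integral_mul`). The joint σ-algebras
may exceed the product ones, so Fubini for real integrable functions is derived from the assumed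
identity for nonnegative ones. Positive definiteness holds because the matrix consists of the
moments `E Z(x)Z(y)`. -/

/-! ### Fubini's theorem from iterated integration of nonnegative functions -/

/-- The measure `τ` is computed by iterated integration, first over `ρ` along the sections
`e x`, then over `ν`. -/
def HasIteratedIntegral {X Y Q : Type*} [MeasurableSpace X] [MeasurableSpace Y]
    [MeasurableSpace Q] (τ : Measure Q) (ν : Measure X) (ρ : Measure Y) (e : X → Y → Q) : Prop :=
  ∀ g : Q → ℝ≥0∞, Measurable g →
    (∀ᵐ x ∂ν, AEMeasurable (fun y => g (e x y)) ρ) ∧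
    AEMeasurable (fun x => ∫⁻ y, g (e x y) ∂ρ) ν ∧
    ∫⁻ q, g q ∂τ = ∫⁻ x, ∫⁻ y, g (e x y) ∂ρ ∂ν

namespace HasIteratedIntegral

variable {X Y Q : Type*} [MeasurableSpace X] [MeasurableSpace Y] [MeasurableSpace Q]
  {τ : Measure Q} {ν : Measure X} {ρ : Measure Y} {e : X → Y → Q}

/-- The exceptional set lies in a measurable null set, whose indicator has zero iterated integral.
This extends the defining property from measurable to a.e. measurable functions. -/
theorem ae_ae (H : HasIteratedIntegral τ ν ρ e) {P : Q → Prop} (h : ∀ᵐ q ∂τ, P q) :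
    ∀ᵐ x ∂ν, ∀ᵐ y ∂ρ, P (e x y) := by
  obtain ⟨N, hN, hmeas, hnull⟩ := exists_measurable_superset_of_null (ae_iff.1 h)
  have hg : Measurable (N.indicator (1 : Q → ℝ≥0∞)) := measurable_one.indicator hmeas
  obtain ⟨h1, h2, h3⟩ := H _ hg
  rw [lintegral_indicator_one hmeas, hnull, eq_comm, lintegral_eq_zero_iff' h2] at h3
  filter_upwards [h1, h3] with x hx1 hx3
  rw [Pi.zero_apply, lintegral_eq_zero_iff' hx1] at hx3
  filter_upwards [hx3] with y hy
  by_contra hP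
  simp [Set.indicator_of_mem (hN hP)] at hy

theorem aemeasurable_section (H : HasIteratedIntegral τ ν ρ e) {g : Q → ℝ≥0∞}
    (hg : AEMeasurable g τ) : ∀ᵐ x ∂ν, AEMeasurable (fun y => g (e x y)) ρ := by
  filter_upwards [(H _ hg.measurable_mk).1, H.ae_ae hg.ae_eq_mk] with x h1 h2
  exact h1.congr (h2.mono fun _ h => h.symm)

theorem lintegral_section_ae_eq (H : HasIteratedIntegral τ ν ρ e) {g g' : Q → ℝ≥0∞}
    (hg : g =ᵐ[τ] g') :
    (fun x => ∫⁻ y, g (e x y) ∂ρ) =ᵐ[ν] fun x => ∫⁻ y, g' (e x y) ∂ρ :=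
  (H.ae_ae hg).mono fun _ h => lintegral_congr_ae h

theorem aemeasurable_lintegral (H : HasIteratedIntegral τ ν ρ e) {g : Q → ℝ≥0∞}
    (hg : AEMeasurable g τ) : AEMeasurable (fun x => ∫⁻ y, g (e x y) ∂ρ) ν :=
  (H _ hg.measurable_mk).2.1.congr (H.lintegral_section_ae_eq hg.ae_eq_mk).symm

theorem lintegral_eq (H : HasIteratedIntegral τ ν ρ e) {g : Q → ℝ≥0∞}
    (hg : AEMeasurable g τ) : ∫⁻ q, g q ∂τ = ∫⁻ x, ∫⁻ y, g (e x y) ∂ρ ∂ν := by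
  rw [lintegral_congr_ae hg.ae_eq_mk, (H _ hg.measurable_mk).2.2]
  exact lintegral_congr_ae (H.lintegral_section_ae_eq hg.ae_eq_mk).symm

theorem measure_univ_eq_mul (H : HasIteratedIntegral τ ν ρ e) :
    τ Set.univ = ρ Set.univ * ν Set.univ := by
  simpa using H.lintegral_eq (g := fun _ => 1) aemeasurable_const

theorem isProbabilityMeasure (H : HasIteratedIntegral τ ν ρ e) [IsProbabilityMeasure ν]
    [IsProbabilityMeasure ρ] : IsProbabilityMeasure τ :=
  ⟨by simp [H.measure_univ_eq_mul]⟩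

theorem aestronglyMeasurable_section (H : HasIteratedIntegral τ ν ρ e) {g : Q → ℝ}
    (hg : AEStronglyMeasurable g τ) :
    ∀ᵐ x ∂ν, AEStronglyMeasurable (fun y => g (e x y)) ρ := by
  filter_upwards [H.aemeasurable_section hg.aemeasurable.ennreal_ofReal,
    H.aemeasurable_section hg.aemeasurable.neg.ennreal_ofReal] with x h1 h2
  refine (h1.ennreal_toReal.sub h2.ennreal_toReal).aestronglyMeasurable.congr
    (ae_of_all _ fun y => ?_)
  rcases le_total 0 (g (e x y)) with h | h <;> simp [ENNReal.toReal_ofReal', h]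

theorem integrable_of_lintegral_lt_top (H : HasIteratedIntegral τ ν ρ e) {g : Q → ℝ}
    (hg : AEStronglyMeasurable g τ) (hfin : ∫⁻ x, ∫⁻ y, ‖g (e x y)‖ₑ ∂ρ ∂ν < ∞) :
    Integrable g τ :=
  ⟨hg, by rwa [HasFiniteIntegral, H.lintegral_eq hg.enorm]⟩

theorem integrable_section (H : HasIteratedIntegral τ ν ρ e) {g : Q → ℝ}
    (hg : Integrable g τ) : ∀ᵐ x ∂ν, Integrable (fun y => g (e x y)) ρ := by
  have hfin : ∫⁻ q, ‖g q‖ₑ ∂τ ≠ ∞ := hg.2.ne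
  rw [H.lintegral_eq hg.1.enorm] at hfin
  filter_upwards [H.aestronglyMeasurable_section hg.1,
    ae_lt_top' (H.aemeasurable_lintegral hg.1.enorm) hfin] with x h1 h2
  exact ⟨h1, h2⟩

/-- Positive and negative parts are treated separately by `key`, applied to `g` and `-g`;
integrability makes both finite, so that they may be subtracted. -/
theorem integrable_integral_and_integral_eq (H : HasIteratedIntegral τ ν ρ e) {g : Q → ℝ}
    (hg : Integrable g τ) :
    Integrable (fun x => ∫ y, g (e x y) ∂ρ) ν ∧ ∫ q, g q ∂τ = ∫ x, ∫ y, g (e x y) ∂ρ ∂ν := by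
  have key : ∀ k : Q → ℝ, Integrable k τ →
      Integrable (fun x => (∫⁻ y, ENNReal.ofReal (k (e x y)) ∂ρ).toReal) ν ∧
      (∫⁻ q, ENNReal.ofReal (k q) ∂τ).toReal
        = ∫ x, (∫⁻ y, ENNReal.ofReal (k (e x y)) ∂ρ).toReal ∂ν := by
    intro k hk
    have hm : AEMeasurable (fun q => ENNReal.ofReal (k q)) τ := hk.1.aemeasurable.ennreal_ofReal
    have hfin : ∫⁻ q, ENNReal.ofReal (k q) ∂τ ≠ ∞ := hk.lintegral_lt_top.ne
    rw [H.lintegral_eq hm] at hfin ⊢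
    exact ⟨integrable_toReal_of_lintegral_ne_top (H.aemeasurable_lintegral hm) hfin,
      (integral_toReal (H.aemeasurable_lintegral hm)
        (ae_lt_top' (H.aemeasurable_lintegral hm) hfin)).symm⟩
  obtain ⟨i1, e1⟩ := key g hg
  obtain ⟨i2, e2⟩ := key (fun q => -g q) hg.neg
  have hae : (fun x => ∫ y, g (e x y) ∂ρ) =ᵐ[ν] fun x =>
      (∫⁻ y, ENNReal.ofReal (g (e x y)) ∂ρ).toReal
        - (∫⁻ y, ENNReal.ofReal (-g (e x y)) ∂ρ).toReal := by
    filter_upwards [H.integrable_section hg] with x hx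
    exact integral_eq_lintegral_pos_part_sub_lintegral_neg_part hx
  refine ⟨(i1.sub i2).congr hae.symm, ?_⟩
  rw [integral_congr_ae hae, integral_sub i1 i2, ← e1, ← e2]
  exact integral_eq_lintegral_pos_part_sub_lintegral_neg_part hg

theorem integrable_integral (H : HasIteratedIntegral τ ν ρ e) {g : Q → ℝ}
    (hg : Integrable g τ) : Integrable (fun x => ∫ y, g (e x y) ∂ρ) ν :=
  (H.integrable_integral_and_integral_eq hg).1

theorem integral_eq (H : HasIteratedIntegral τ ν ρ e) {g : Q → ℝ} (hg : Integrable g τ) :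
    ∫ q, g q ∂τ = ∫ x, ∫ y, g (e x y) ∂ρ ∂ν :=
  (H.integrable_integral_and_integral_eq hg).2

end HasIteratedIntegral

/-! ### Fubini extensions, in both orders of integration -/

namespace FubiniExtension

variable {X Y : Type*} [MeasurableSpace X] [MeasurableSpace Y] {ν : Measure X} {ρ : Measure Y}

theorem hasIteratedIntegral_left (J : FubiniExtension ν ρ) :
    @HasIteratedIntegral X Y (X × Y) _ _ J.sigma J.joint ν ρ Prod.mk :=
  J.left

theorem hasIteratedIntegral_right (J : FubiniExtension ν ρ) :
    @HasIteratedIntegral Y X (X × Y) _ _ J.sigma J.joint ρ ν (fun y x => (x, y)) :=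
  J.right

theorem measurable_fst (J : FubiniExtension ν ρ) :
    Measurable[J.sigma] (Prod.fst : X × Y → X) :=
  fun _ hs => J.prod_le _ (_root_.measurable_fst hs)

theorem measurable_snd (J : FubiniExtension ν ρ) :
    Measurable[J.sigma] (Prod.snd : X × Y → Y) :=
  fun _ hs => J.prod_le _ (_root_.measurable_snd hs)

/-- The preimage of `s` has measure `ν univ * ρ s`, which vanishes with `ρ s` even if `ν` is
infinite. It serves to lift variables on the second factor to the joint space. -/
theorem quasiMeasurePreserving_snd (J : FubiniExtension ν ρ) :
    @Measure.QuasiMeasurePreserving (X × Y) Y _ J.sigma Prod.snd J.joint ρ := by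
  let := J.sigma
  refine ⟨J.measurable_snd, Measure.AbsolutelyContinuous.mk fun s hs h0 => ?_⟩
  rw [Measure.map_apply J.measurable_snd hs, ← lintegral_indicator_one (J.measurable_snd hs),
    J.hasIteratedIntegral_right.lintegral_eq
      (measurable_one.indicator (J.measurable_snd hs)).aemeasurable]
  have : ∀ y, ∫⁻ x, (Prod.snd ⁻¹' s).indicator (1 : X × Y → ℝ≥0∞) (x, y) ∂ν
      = s.indicator (fun _ => ν Set.univ) y := by
    intro y
    by_cases hy : y ∈ s <;> simp [Set.indicator, hy]
  simp [this, lintegral_indicator hs, h0]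

end FubiniExtension

/-! ### Mean square stochastic integrals and the Itô isometry -/

theorem tendsto_integral_mul_of_tendsto_eLpNorm {α : Type*} [MeasurableSpace α] {m : Measure α}
    {X Y : ℕ → α → ℝ} {X₀ Y₀ : α → ℝ} (hX : ∀ n, MemLp (X n) 2 m) (hY : ∀ n, MemLp (Y n) 2 m)
    (hX₀ : MemLp X₀ 2 m) (hY₀ : MemLp Y₀ 2 m)
    (hXl : Tendsto (fun n => eLpNorm (fun a => X n a - X₀ a) 2 m) atTop (𝓝 0))
    (hYl : Tendsto (fun n => eLpNorm (fun a => Y n a - Y₀ a) 2 m) atTop (𝓝 0)) :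
    Tendsto (fun n => ∫ a, X n a * Y n a ∂m) atTop (𝓝 (∫ a, X₀ a * Y₀ a ∂m)) := by
  have hinner : ∀ {F G : α → ℝ} (hF : MemLp F 2 m) (hG : MemLp G 2 m),
      inner ℝ (hF.toLp F) (hG.toLp G) = ∫ a, F a * G a ∂m := by
    intro F G hF hG
    rw [L2.inner_def]
    refine integral_congr_ae ?_
    filter_upwards [hF.coeFn_toLp, hG.coeFn_toLp] with a h1 h2
    simp [h1, h2, mul_comm]
  simp only [← hinner (hX _) (hY _), ← hinner hX₀ hY₀]
  exact ((Lp.tendsto_Lp_iff_tendsto_eLpNorm'' _ hX _ hX₀).2 hXl).inner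
    ((Lp.tendsto_Lp_iff_tendsto_eLpNorm'' _ hY _ hY₀).2 hYl)

section

variable {S Ω : Type*} [MeasurableSpace S] [MeasurableSpace Ω] {W : Set S → Ω → ℝ} {lam : ℝ}
  {ν : Measure S} {P : Measure Ω}

/-- The fibre over `0` may have infinite measure, where nothing is known about `W`; below, the
coefficient `0` always removes it. -/
theorem measure_preimage_singleton_lt_top {s : SimpleFunc S ℝ} (hs : MemLp s 2 ν) {c : ℝ}
    (hc : c ≠ 0) : ν (s ⁻¹' {c}) < ∞ :=
  SimpleFunc.measure_preimage_lt_top_of_memLp (by norm_num) (by norm_num) s hs c hc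

namespace IsOrthogonalRandomMeasure

theorem memLp_const_mul (hW : IsOrthogonalRandomMeasure W lam ν P) {s : SimpleFunc S ℝ}
    (hs : MemLp s 2 ν) (c : ℝ) : MemLp (fun ω => c * W (s ⁻¹' {c}) ω) 2 P := by
  rcases eq_or_ne c 0 with rfl | hc
  · simp
  · exact (hW.memLp _ (s.measurableSet_fiber c)
      (measure_preimage_singleton_lt_top hs hc)).const_mul c

theorem memLp_simpleStochasticIntegral (hW : IsOrthogonalRandomMeasure W lam ν P)
    {s : SimpleFunc S ℝ} (hs : MemLp s 2 ν) : MemLp (simpleStochasticIntegral W s) 2 P :=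
  memLp_finsetSum _ fun c _ => hW.memLp_const_mul hs c

theorem integral_simpleStochasticIntegral [IsFiniteMeasure P]
    (hW : IsOrthogonalRandomMeasure W lam ν P)
    {s : SimpleFunc S ℝ} (hs : MemLp s 2 ν) : ∫ ω, simpleStochasticIntegral W s ω ∂P = 0 := by
  unfold simpleStochasticIntegral
  rw [integral_finsetSum _ fun c _ => (hW.memLp_const_mul hs c).integrable (by norm_num)]
  refine Finset.sum_eq_zero fun c _ => ?_
  rcases eq_or_ne c 0 with rfl | hc
  · simp
  · rw [integral_const_mul, hW.mean _ (s.measurableSet_fiber c)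
      (measure_preimage_singleton_lt_top hs hc), mul_zero]

/-- The Itô isometry for simple functions. -/
theorem integral_simpleStochasticIntegral_mul (hW : IsOrthogonalRandomMeasure W lam ν P)
    {s r : SimpleFunc S ℝ} (hs : MemLp s 2 ν) (hr : MemLp r 2 ν) :
    ∫ ω, simpleStochasticIntegral W s ω * simpleStochasticIntegral W r ω ∂P
      = lam * ∫ u, s u * r u ∂ν := by
  -- On the common refinement into intersections of fibres, the isometry reduces termwise to
  -- orthogonality of `W`.
  have hexp : ∀ u, s u * r u = ∑ c ∈ s.range, ∑ d ∈ r.range,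
      (s ⁻¹' {c} ∩ r ⁻¹' {d}).indicator (fun _ => c * d) u := by
    intro u
    rw [Finset.sum_eq_single (s u), Finset.sum_eq_single (r u)]
    · simp
    · intro d _ hd
      simp [hd.symm]
    · simp
    · intro c _ hc
      exact Finset.sum_eq_zero fun d _ => by simp [hc.symm]
    · simp
  have hms : ∀ c d, MeasurableSet (s ⁻¹' {c} ∩ r ⁻¹' {d}) := fun c d =>
    (s.measurableSet_fiber c).inter (r.measurableSet_fiber d)
  have hint : ∀ c d, Integrable ((s ⁻¹' {c} ∩ r ⁻¹' {d}).indicator (fun _ => c * d)) ν := by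
    intro c d
    rcases eq_or_ne c 0 with rfl | hc
    · simp
    · exact (integrable_indicator_iff (hms c d)).2 (integrableOn_const
        ((measure_mono Set.inter_subset_left).trans_lt
          (measure_preimage_singleton_lt_top hs hc)).ne)
  simp only [hexp]
  rw [integral_finsetSum _ fun c _ => integrable_finsetSum _ fun d _ => hint c d,
    Finset.mul_sum]
  unfold simpleStochasticIntegral
  simp only [Finset.sum_mul_sum]
  have hprod : ∀ c d, Integrable
      (fun ω => c * W (s ⁻¹' {c}) ω * (d * W (r ⁻¹' {d}) ω)) P := fun c d =>
    (hW.memLp_const_mul hs c).integrable_mul (hW.memLp_const_mul hr d)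
  rw [integral_finsetSum _ fun c _ => integrable_finsetSum _ fun d _ => hprod c d]
  refine Finset.sum_congr rfl fun c _ => ?_
  rw [integral_finsetSum _ fun d _ => hint c d, integral_finsetSum _ fun d _ => hprod c d,
    Finset.mul_sum]
  refine Finset.sum_congr rfl fun d _ => ?_
  rw [integral_indicator_const _ (hms c d)]
  rcases eq_or_ne c 0 with rfl | hc
  · simp
  rcases eq_or_ne d 0 with rfl | hd
  · simp
  simp only [mul_mul_mul_comm c _ d]
  rw [integral_const_mul, hW.orthogonal _ _ (s.measurableSet_fiber c) (r.measurableSet_fiber d)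
    (measure_preimage_singleton_lt_top hs hc) (measure_preimage_singleton_lt_top hr hd)]
  simp only [smul_eq_mul]
  ring

end IsOrthogonalRandomMeasure

namespace IsStochasticIntegral

variable {h k : S → ℝ} {Y V : Ω → ℝ}

theorem integral_eq_zero [IsFiniteMeasure P] (hW : IsOrthogonalRandomMeasure W lam ν P)
    (hY : IsStochasticIntegral W ν P h Y) : ∫ ω, Y ω ∂P = 0 := by
  obtain ⟨-, hY2, s, hs, -, hlim⟩ := hY
  have := tendsto_integral_mul_of_tendsto_eLpNorm
    (fun n => hW.memLp_simpleStochasticIntegral (hs n)) (fun _ => memLp_const (1 : ℝ)) hY2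
    (memLp_const (1 : ℝ)) hlim (by simp)
  simp only [mul_one, hW.integral_simpleStochasticIntegral (hs _)] at this
  exact tendsto_nhds_unique this tendsto_const_nhds

/-- The Itô isometry. -/
theorem integral_mul (hW : IsOrthogonalRandomMeasure W lam ν P)
    (hY : IsStochasticIntegral W ν P h Y) (hV : IsStochasticIntegral W ν P k V) :
    ∫ ω, Y ω * V ω ∂P = lam * ∫ u, h u * k u ∂ν := by
  obtain ⟨hh, hY2, s, hs, hsh, hsY⟩ := hY
  obtain ⟨hk, hV2, r, hr, hrk, hrV⟩ := hV
  have h1 := tendsto_integral_mul_of_tendsto_eLpNorm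
    (fun n => hW.memLp_simpleStochasticIntegral (hs n))
    (fun n => hW.memLp_simpleStochasticIntegral (hr n)) hY2 hV2 hsY hrV
  simp only [hW.integral_simpleStochasticIntegral_mul (hs _) (hr _)] at h1
  exact tendsto_nhds_unique h1
    ((tendsto_integral_mul_of_tendsto_eLpNorm hs hr hh hk hsh hrk).const_mul lam)

theorem indicator_const (hW : IsOrthogonalRandomMeasure W lam ν P) {A : Set S}
    (hA : MeasurableSet A) (hfin : ν A < ∞) (hne : A.Nonempty)
    (c : ℝ) :
    IsStochasticIntegral W ν P (A.indicator fun _ => c) (fun ω => c * W A ω) := by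
  classical
  have hmem : MemLp (A.indicator fun _ => c) 2 ν := memLp_indicator_const 2 hA c (Or.inr hfin.ne)
  set s : SimpleFunc S ℝ := SimpleFunc.piecewise A hA (.const S c) (.const S 0)
  have hs : (s : S → ℝ) = A.indicator fun _ => c := by
    ext u; simp [s, Set.indicator, Set.piecewise]
  have hI : ∀ ω, simpleStochasticIntegral W s ω = c * W A ω := by
    intro ω
    unfold simpleStochasticIntegral
    -- For `c = 0` the fibre over `c` is the whole space, not `A`. For `c ≠ 0`, nonemptiness of `A`
    -- puts `c` in the range, so the identity holds for every `ω`.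
    rcases eq_or_ne c 0 with rfl | hc
    · refine (Finset.sum_eq_zero fun d hd => ?_).trans (zero_mul _).symm
      obtain ⟨u, rfl⟩ := SimpleFunc.mem_range.1 hd
      simp [hs]
    have hpre : (A.indicator fun _ => c) ⁻¹' {c} = A := by
      ext u; by_cases hu : u ∈ A <;> simp [hu, hc.symm]
    obtain ⟨a, ha⟩ := hne
    rw [Finset.sum_eq_single c, hs, hpre]
    · intro d hd hdc
      obtain ⟨u, rfl⟩ := SimpleFunc.mem_range.1 hd
      by_cases hu : u ∈ A <;> simp_all
    · intro hcr
      exact absurd (SimpleFunc.mem_range.2 ⟨a, by simp [hs, ha]⟩) hcr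
  refine ⟨hmem, (hW.memLp A hA hfin).const_mul c, fun _ => s, fun _ => hs ▸ hmem, ?_, ?_⟩
  · simp [hs]
  · simp [hI]

end IsStochasticIntegral

end

/-! ### Moments of the convolution model -/

namespace IsConvolutionModel

variable {p : ℕ} {G : Set (EuclideanSpace ℝ (Fin p))} {𝒯 : Set ℝ}
  {Θ Ω : Type*} [MeasurableSpace (Site p)] [MeasurableSpace Θ] [MeasurableSpace Ω]
  {lam : ℝ} {μ : Measure 𝒯} {ν : Measure (Site p)} {PΘ : Measure Θ} {PΩ : Measure Ω}
  {J : FubiniExtension ν PΘ} {K : FubiniExtension PΘ PΩ}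
  {W : Set (Site p) → Ω → ℝ} {T : Site p → Θ → 𝒯}
  {f : G → EuclideanSpace ℝ (Fin p) → 𝒯 → ℝ} {Z : G → Θ × Ω → ℝ}

/-- Under the joint law, the pair of a site and the value of `T` at that site is distributed as
the product of Lebesgue measure and `μ`. -/
theorem measurePreserving_loc_T [SFinite μ]
    (hZ : IsConvolutionModel lam μ ν PΘ PΩ J K W T f Z) :
    @MeasurePreserving _ _ J.sigma _ (fun q : Site p × Θ => (Site.loc q.1, T q.1 q.2))
      J.joint (volume.prod μ) := by
  let := J.sigma
  have hm : Measurable (fun q : Site p × Θ => (Site.loc q.1, T q.1 q.2)) :=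
    (hZ.lebesgue.measurable.comp J.measurable_fst).prodMk hZ.jointly_measurable_T
  refine ⟨hm, Measure.ext fun A hA => ?_⟩
  have hg : Measurable (A.indicator (1 : EuclideanSpace ℝ (Fin p) × 𝒯 → ℝ≥0∞)) :=
    measurable_one.indicator hA
  rw [← lintegral_indicator_one hA, ← lintegral_indicator_one hA, lintegral_map hg hm,
    lintegral_prod _ hg.aemeasurable, ← hZ.lebesgue.lintegral_comp hg.lintegral_prod_right']
  refine (J.hasIteratedIntegral_left.lintegral_eq (hg.comp hm).aemeasurable).trans
    (lintegral_congr fun u => ?_)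
  rw [← hZ.law_T u]
  exact (lintegral_map (hg.comp measurable_prodMk_left) (hZ.measurable_T u)).symm

/-- Since `T u` has law `μ`, the moment assumptions say exactly that the square has finite iterated
integral, over `t` and then over `u`. -/
theorem memLp_prod [IsProbabilityMeasure μ]
    (hZ : IsConvolutionModel lam μ ν PΘ PΩ J K W T f Z) (x : G) :
    MemLp (fun q : EuclideanSpace ℝ (Fin p) × 𝒯 => f x q.1 q.2) 2 (volume.prod μ) := by
  have hsq := (hZ.measurable_f x).pow_const 2
  have hsec : ∀ u, Measurable (f x u) := fun u => (hZ.measurable_f x).comp measurable_prodMk_left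
  rw [memLp_two_iff_integrable_sq (hZ.measurable_f x).aestronglyMeasurable,
    integrable_prod_iff hsq.aestronglyMeasurable]
  constructor
  · refine ae_of_all _ fun u => ?_
    have h := (hZ.finite_moments x u).integrable_sq
    rw [← hZ.law_T u]
    exact (integrable_map_measure ((hsec u).pow_const 2).aestronglyMeasurable
      (hZ.measurable_T u).aemeasurable).2 h
  · have hmeas : StronglyMeasurable fun u => ∫ t, ‖f x u t ^ 2‖ ∂μ :=
      hsq.stronglyMeasurable.norm.integral_prod_right'
    refine (hZ.lebesgue.integrable_comp hmeas.aestronglyMeasurable).1 ?_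
    refine (hZ.integrable_second x).congr (ae_of_all _ fun u => ?_)
    simp only [Function.comp_apply, Real.norm_eq_abs, abs_pow, sq_abs]
    rw [← hZ.law_T u]
    exact (integral_map (hZ.measurable_T u).aemeasurable
      ((hsec _).pow_const 2).aestronglyMeasurable).symm

theorem integrable_mul_prod [IsProbabilityMeasure μ]
    (hZ : IsConvolutionModel lam μ ν PΘ PΩ J K W T f Z) (x y : G) :
    Integrable (fun q : EuclideanSpace ℝ (Fin p) × 𝒯 => f x q.1 q.2 * f y q.1 q.2)
      (volume.prod μ) :=
  (hZ.memLp_prod x).integrable_mul (hZ.memLp_prod y)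

theorem integrable_convolutionCov [IsProbabilityMeasure μ]
    (hZ : IsConvolutionModel lam μ ν PΘ PΩ J K W T f Z) (x y : G) :
    Integrable (convolutionCov f x y) μ :=
  (hZ.integrable_mul_prod x y).integral_prod_right

theorem integrable_joint [IsProbabilityMeasure μ]
    (hZ : IsConvolutionModel lam μ ν PΘ PΩ J K W T f Z) (x y : G) :
    @Integrable _ _ _ _ J.sigma (fun q : Site p × Θ =>
      f x (Site.loc q.1) (T q.1 q.2) * f y (Site.loc q.1) (T q.1 q.2)) J.joint := by
  let := J.sigma
  exact hZ.measurePreserving_loc_T.integrable_comp_of_integrable (hZ.integrable_mul_prod x y)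

theorem integrable_integral_mul [IsProbabilityMeasure μ]
    (hZ : IsConvolutionModel lam μ ν PΘ PΩ J K W T f Z) (x y : G) :
    Integrable (fun θ => ∫ u, f x (Site.loc u) (T u θ) * f y (Site.loc u) (T u θ) ∂ν) PΘ := by
  let := J.sigma
  exact J.hasIteratedIntegral_right.integrable_integral (hZ.integrable_joint x y)

theorem integral_integral_mul [IsProbabilityMeasure μ]
    (hZ : IsConvolutionModel lam μ ν PΘ PΩ J K W T f Z) (x y : G) :
    ∫ θ, ∫ u, f x (Site.loc u) (T u θ) * f y (Site.loc u) (T u θ) ∂ν ∂PΘ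
      = ∫ t, convolutionCov f x y t ∂μ := by
  let := J.sigma
  have hmp := hZ.measurePreserving_loc_T
  have hint := hZ.integrable_mul_prod x y
  refine (J.hasIteratedIntegral_right.integral_eq (hZ.integrable_joint x y)).symm.trans ?_
  refine Eq.trans ?_ (integral_prod_symm _ hint)
  have hmap := integral_map hmp.measurable.aemeasurable (hmp.map_eq.symm ▸ hint.1)
  rw [hmp.map_eq] at hmap
  exact hmap.symm

/-- By the isometry the conditional second moment given `θ` is `lam * ∫ f_x²`, which is integrable
in `θ`. -/
theorem memLp [IsProbabilityMeasure μ]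
    (hZ : IsConvolutionModel lam μ ν PΘ PΩ J K W T f Z) (x : G) : MemLp (Z x) 2 K.joint := by
  let := K.sigma
  have hm : AEStronglyMeasurable (Z x) K.joint := hZ.measurable_Z x
  refine (memLp_two_iff_integrable_sq hm).2 ?_
  refine K.hasIteratedIntegral_left.integrable_of_lintegral_lt_top (hm.pow 2) ?_
  have hfin := ((hZ.integrable_integral_mul x x).const_mul lam).2
  refine (lintegral_congr_ae ?_).trans_lt hfin
  filter_upwards [hZ.integral_Z x] with θ hθ
  rw [← hθ.integral_mul hZ.noise hθ, Real.enorm_of_nonneg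
    (integral_nonneg fun _ => mul_self_nonneg _), ofReal_integral_eq_lintegral_ofReal
    (f := fun ω => Z x (θ, ω) * Z x (θ, ω)) (hθ.2.1.integrable_mul hθ.2.1) (ae_of_all _ fun _ => mul_self_nonneg _)]
  refine lintegral_congr fun ω => ?_
  rw [Real.enorm_of_nonneg (sq_nonneg _), pow_two]

theorem integral_eq_zero [IsProbabilityMeasure μ] [IsProbabilityMeasure PΘ]
    [IsProbabilityMeasure PΩ] (hZ : IsConvolutionModel lam μ ν PΘ PΩ J K W T f Z) (x : G) :
    ∫ q, Z x q ∂K.joint = 0 := by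
  let := K.sigma
  have : IsProbabilityMeasure K.joint := K.hasIteratedIntegral_left.isProbabilityMeasure
  rw [K.hasIteratedIntegral_left.integral_eq ((hZ.memLp x).integrable (by norm_num))]
  refine integral_eq_zero_of_ae ?_
  filter_upwards [hZ.integral_Z x] with θ hθ
  exact hθ.integral_eq_zero hZ.noise

theorem integral_mul [IsProbabilityMeasure μ]
    (hZ : IsConvolutionModel lam μ ν PΘ PΩ J K W T f Z) (hlam : 0 ≤ lam) (x y : G) :
    ∫ q, Z x q * Z y q ∂K.joint = ∫ t, convolutionCov f x y t ∂(mixingMeasure lam μ) := by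
  let := K.sigma
  have hint : Integrable (fun q => Z x q * Z y q) K.joint :=
    (hZ.memLp x).integrable_mul (hZ.memLp y)
  rw [K.hasIteratedIntegral_left.integral_eq hint, mixingMeasure, integral_smul_measure,
    ENNReal.toReal_ofReal hlam, ← hZ.integral_integral_mul, smul_eq_mul, ← integral_const_mul]
  refine integral_congr_ae ?_
  filter_upwards [hZ.integral_Z x, hZ.integral_Z y] with θ hx hy
  exact hx.integral_mul hZ.noise hy

theorem covariance_eq [IsProbabilityMeasure μ] [IsProbabilityMeasure PΘ]
    [IsProbabilityMeasure PΩ] (hZ : IsConvolutionModel lam μ ν PΘ PΩ J K W T f Z)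
    (hlam : 0 ≤ lam) (x y : G) :
    cov[Z x, Z y; K.joint] = ∫ t, convolutionCov f x y t ∂(mixingMeasure lam μ) := by
  let := K.sigma
  have : IsProbabilityMeasure K.joint := K.hasIteratedIntegral_left.isProbabilityMeasure
  rw [covariance_eq_sub (hZ.memLp x) (hZ.memLp y), hZ.integral_eq_zero x, zero_mul, sub_zero,
    ← hZ.integral_mul hlam]
  rfl

/-- This is a Gram matrix in L²: its quadratic form at `a` is `E (∑ a_x Z(x))²`. -/
theorem posSemidef [IsProbabilityMeasure μ]
    (hZ : IsConvolutionModel lam μ ν PΘ PΩ J K W T f Z) (hlam : 0 ≤ lam) :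
    (Matrix.of fun x y : G =>
      ∫ t, convolutionCov f x y t ∂(mixingMeasure lam μ)).PosSemidef := by
  let := K.sigma
  simp only [← hZ.integral_mul hlam]
  refine ⟨?_, fun a => ?_⟩
  · ext x y
    simp [Matrix.conjTranspose_apply, mul_comm]
  have hint : ∀ x y, Integrable (fun q => a x * Z x q * (a y * Z y q)) K.joint := fun x y =>
    ((hZ.memLp x).const_mul (a x)).integrable_mul ((hZ.memLp y).const_mul (a y))
  have hsum : ∫ q, (∑ x ∈ a.support, a x * Z x q) * (∑ y ∈ a.support, a y * Z y q) ∂K.joint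
      = ∑ x ∈ a.support, ∑ y ∈ a.support, a x * (∫ q, Z x q * Z y q ∂K.joint) * a y := by
    simp only [Finset.sum_mul_sum]
    rw [integral_finsetSum _ fun x _ => integrable_finsetSum _ fun y _ => hint x y]
    refine Finset.sum_congr rfl fun x _ => ?_
    rw [integral_finsetSum _ fun y _ => hint x y]
    refine Finset.sum_congr rfl fun y _ => ?_
    simp only [mul_mul_mul_comm (a x) _ (a y)]
    rw [integral_const_mul]
    ring
  exact (integral_nonneg fun q => mul_self_nonneg _).trans_eq hsum

/-! ### A non-stationary example -/

/-- With the same randomness, the weighting functions `c_x 1_A` give the model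
`Z'(x) = c_x W(A)`. -/
theorem indicator_model [IsProbabilityMeasure PΘ]
    (hZ : IsConvolutionModel lam μ ν PΘ PΩ J K W T f Z)
    {A : Set (EuclideanSpace ℝ (Fin p))} (hA : MeasurableSet A) (hfin : volume A < ∞)
    (hne : A.Nonempty) (c : G → ℝ) :
    IsConvolutionModel lam μ ν PΘ PΩ J K W T (fun x u _ => A.indicator (fun _ => c x) u)
      (fun x q => c x * W (Site.loc ⁻¹' A) q.2) := by
  have hA' : MeasurableSet (Site.loc ⁻¹' A : Set (Site p)) := hZ.lebesgue.measurable hA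
  have hfin' : ν (Site.loc ⁻¹' A) < ∞ := by
    rwa [hZ.lebesgue.measure_preimage hA.nullMeasurableSet]
  have hint : ∀ r : ℝ, Integrable (fun u : Site p => A.indicator (fun _ => r) (Site.loc u)) ν :=
    fun r => hZ.lebesgue.integrable_comp_of_integrable
      ((integrable_indicator_iff hA).2 (integrableOn_const hfin.ne))
  refine ⟨hZ.lebesgue, hZ.noise, hZ.measurable_T, hZ.jointly_measurable_T, hZ.indep_T, hZ.law_T,
    fun x => (measurable_const.indicator hA).comp measurable_fst,
    fun x t => memLp_indicator_const 2 hA (c x) (Or.inr hfin.ne), fun x u => memLp_const _,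
    fun x => ?_, fun x => ?_, fun x => ?_, fun x => ae_of_all _ fun θ => ?_⟩
  · simpa using hint (c x)
  · refine (hint (c x ^ 2)).congr (ae_of_all _ fun u => ?_)
    by_cases hu : Site.loc u ∈ A <;> simp [hu]
  · let := K.sigma
    exact ((hZ.noise.memLp _ hA' hfin').1.comp_quasiMeasurePreserving
      K.quasiMeasurePreserving_snd).const_mul (c x)
  · exact IsStochasticIntegral.indicator_const hZ.noise hA' hfin' hne (c x)

theorem exists_not_isStationaryCovariance [IsProbabilityMeasure μ] [IsProbabilityMeasure PΘ]
    [IsProbabilityMeasure PΩ] (hZ : IsConvolutionModel lam μ ν PΘ PΩ J K W T f Z)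
    (hlam : 0 < lam) (hG : G.Nontrivial) :
    ∃ (f' : G → EuclideanSpace ℝ (Fin p) → 𝒯 → ℝ) (Z' : G → Θ × Ω → ℝ),
      IsConvolutionModel lam μ ν PΘ PΩ J K W T f' Z' ∧
      ¬ IsStationaryCovariance (fun x y : G => cov[Z' x, Z' y; K.joint]) := by
  classical
  obtain ⟨x, hx, y, hy, hxy⟩ := hG
  set A : Set (EuclideanSpace ℝ (Fin p)) := Metric.ball 0 1
  have hpos : 0 < volume.real A :=
    ENNReal.toReal_pos (Metric.measure_ball_pos _ _ one_pos).ne' measure_ball_lt_top.ne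
  -- The covariance of this model is `lam |A| c_x c_y`. The weights 2 and 1 give variances `4 lam
  -- |A|` and `lam |A|` at two points, whereas stationarity forces equal variances because `x - x =
  -- y - y`.
  have hmodel := hZ.indicator_model (A := A) measurableSet_ball measure_ball_lt_top
    ⟨0, Metric.mem_ball_self one_pos⟩ (fun z => if z = ⟨x, hx⟩ then 2 else 1)
  refine ⟨_, _, hmodel, fun hstat => ?_⟩
  have h := (hmodel.covariance_eq hlam.le ⟨x, hx⟩ ⟨x, hx⟩).symm.trans
    ((hstat ⟨x, hx⟩ ⟨x, hx⟩ ⟨y, hy⟩ ⟨y, hy⟩ (by simp)).trans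
      (hmodel.covariance_eq hlam.le ⟨y, hy⟩ ⟨y, hy⟩))
  have hne : (⟨y, hy⟩ : G) ≠ ⟨x, hx⟩ := fun h => hxy (congrArg Subtype.val h).symm
  have hind : ∀ r : ℝ, ∫ u, A.indicator (fun _ => r) u * A.indicator (fun _ => r) u
      = volume.real A * (r * r) := by
    intro r
    simp only [← Set.indicator_mul]
    exact integral_indicator_const _ measurableSet_ball
  simp only [convolutionCov, hind, mixingMeasure, integral_const,
    measureReal_ennreal_smul_apply, ENNReal.toReal_ofReal hlam.le, hne, if_true, if_false,
    probReal_univ, smul_eq_mul] at h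
  nlinarith [mul_pos hlam hpos]

end IsConvolutionModel

/-- The moments of the generalized convolution model: `Z` is centred and of second order, its
covariance is the mixture of convolutions `∫ C(x, y; t) M(dt)`, this is positive definite, and
the model is not confined to stationary covariances. -/
theorem proposition1 {p : ℕ} (hp : 1 ≤ p) {G : Set (EuclideanSpace ℝ (Fin p))} {𝒯 : Set ℝ}
    {Θ Ω : Type*} [MeasurableSpace (Site p)] [MeasurableSpace Θ] [MeasurableSpace Ω]
    (lam : ℝ) (hlam : 0 < lam) (μ : Measure 𝒯) [IsProbabilityMeasure μ]
    (ν : Measure (Site p))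
    (PΘ : Measure Θ) [IsProbabilityMeasure PΘ] (PΩ : Measure Ω) [IsProbabilityMeasure PΩ]
    (J : FubiniExtension ν PΘ) (K : FubiniExtension PΘ PΩ)
    (W : Set (Site p) → Ω → ℝ) (T : Site p → Θ → 𝒯)
    (f : G → EuclideanSpace ℝ (Fin p) → 𝒯 → ℝ) (Z : G → Θ × Ω → ℝ)
    (hZ : IsConvolutionModel lam μ ν PΘ PΩ J K W T f Z) :
    (∀ x, MemLp (Z x) 2 K.joint) ∧
    (∀ x, ∫ q, Z x q ∂K.joint = 0) ∧
    (∀ x y t, Integrable (fun u => f x u t * f y u t) volume) ∧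
    (∀ x y, Integrable (convolutionCov f x y) (mixingMeasure lam μ) ∧
      cov[Z x, Z y; K.joint] = ∫ t, convolutionCov f x y t ∂(mixingMeasure lam μ)) ∧
    (Matrix.of fun x y : G =>
      ∫ t, convolutionCov f x y t ∂(mixingMeasure lam μ)).PosSemidef ∧
    (G.Nontrivial → ∃ (f' : G → EuclideanSpace ℝ (Fin p) → 𝒯 → ℝ) (Z' : G → Θ × Ω → ℝ),
      IsConvolutionModel lam μ ν PΘ PΩ J K W T f' Z' ∧
      ¬ IsStationaryCovariance (fun x y : G => cov[Z' x, Z' y; K.joint])) :=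
  ⟨hZ.memLp, hZ.integral_eq_zero, fun x y t => (hZ.memLp_f x t).integrable_mul (hZ.memLp_f y t),
    fun x y => ⟨(hZ.integrable_convolutionCov x y).smul_measure ENNReal.ofReal_ne_top,
      hZ.covariance_eq hlam.le x y⟩,
    hZ.posSemidef hlam.le, hZ.exists_not_isStationaryCovariance hlam⟩
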